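/- A deterministic comparison-based algorithm $\mathcal{A}$ for element distinctness receives a list $I$ of $n$ elements of an arbitrary totally ordered set. For each $n$ it is a finite decision tree, which adaptively compares two entries of $I$, each comparison returning $<$, $=$ or $>$, and learns nothing else about $I$. It must output two different positions of $I$ that hold equal entries, or report (correctly) that there are none. Its running time on $I$ is the number of comparisons that it makes. Let $G(I)$ be the graph on $\{1,\dots,n\}$ in which $i \ne j$ are adjacent if and only if $I[i]=I[j]$. For an $n$-vertex graph $G$ that is a disjoint union of cliques, let $\operatorname{Universal}(\mathcal{A},G)$ be the maximum running time of $\mathcal{A}$ over all inputs $I$ with $G(I)\cong G$. Call the connected components of $G$ its clusters. For an integer $L$, let $C(L)$ be the total size of all clusters of $G$ of size smaller than $L$, and let $D(L)$ be the number of clusters of $G$ of size at least $L$. Logarithms are to base $2$, $C(L)\log\frac{C(L)}{L}$ is read as $0$ if $C(L)=0$, $L$ ranges over integers, and a minimum over the empty set is $+\infty$. Theorem. There is an algorithm $\mathcal{A}$ for element distinctness, which depends on $n$ but not on $G$, and a constant $c>0$ such that for every $n\ge 3$ and every $n$-vertex disjoint union of cliques $G$, \[ \operatorname{Universal}(\mathcal{A},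 G) \le c\,\log\log (n) \cdot \min\Big( \min_{\substack{L \ge 2\\ C(L) < n}} \big(n + C(L) \log \tfrac{C(L)}{L}\big),\ \min_{\substack{L \ge 1\\ C(L) < \frac{n}{2}}} \big(C(L) + D(L)\big) \max\{1, \log D(L)\}\Big). \] -/

import Mathlib

universe u

namespace ElementDistinctness

/-- A deterministic comparison-based algorithm on lists of length `n`: a finite ternary decision
tree. It may adaptively compare two entries of the list, and it learns nothing about the input but
the answers `<`, `=`, `>`. It stops by reporting two positions, or by reporting that the entries
are pairwise distinct. -/
inductive Algorithm (n : ℕ) : Type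
  | reportPair (i j : Fin n) : Algorithm n
  | reportDistinct : Algorithm n
  | query (i j : Fin n) (next : Ordering → Algorithm n) : Algorithm n

namespace Algorithm

variable {n : ℕ} {U : Type u} [LinearOrder U]

/-- The answer on the input `I`: a pair of positions, or `none` for "no duplicates". -/
def output : Algorithm n → (Fin n → U) → Option (Fin n × Fin n)
  | reportPair i j, _ => some (i, j)
  | reportDistinct, _ => none
  | query i j next, I => output (next (cmp (I i) (I j))) I

/-- The running time on the input `I`: the number of comparisons made before stopping. -/
def runtime : Algorithm n → (Fin n → U) → ℕ
  | reportPair _ _, _ => 0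
  | reportDistinct, _ => 0
  | query i j next, I => runtime (next (cmp (I i) (I j))) I + 1

end Algorithm

/-- `A` is a correct algorithm for element distinctness on all lists of length `n`, over every
totally ordered set: a reported pair is a pair of equal entries at two different positions, and
"no duplicates" is only reported if there are none. -/
def Solves {n : ℕ} (A : Algorithm n) : Prop :=
  ∀ (U : Type u) [LinearOrder U] (I : Fin n → U),
    (∀ i j : Fin n, A.output I = some (i, j) → i ≠ j ∧ I i = I j) ∧
    (A.output I = none → Function.Injective I)

/-- The graph `G(I)`: two positions are adjacent iff they are different and hold equal entries. -/
def dupGraph {n : ℕ} {U : Type u} (I : Fin n → U) : SimpleGraph (Fin n) where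
  Adj i j := i ≠ j ∧ I i = I j
  symm := ⟨fun _ _ h => ⟨h.1.symm, h.2.symm⟩⟩
  loopless := ⟨fun _ h => h.1 rfl⟩

/-- `G` is a disjoint union of cliques: all its connected components are cliques. -/
def IsCliqueUnion {n : ℕ} (G : SimpleGraph (Fin n)) : Prop :=
  ∀ c : G.ConnectedComponent, G.IsClique c.supp

/-- `Universal(A, G)`: the worst running time of `A` over all totally ordered sets `U` and all
inputs `I` from `U` whose duplicate graph is isomorphic to `G`. -/
noncomputable def universal {n : ℕ} (A : Algorithm n) (G : SimpleGraph (Fin n)) : ℕ∞ :=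
  ⨆ (U : Type u) (_ : LinearOrder U) (I : Fin n → U) (_ : Nonempty (dupGraph I ≃g G)),
    (A.runtime I : ℕ∞)

/-- `C(L)`: the total size of the clusters (connected components) of size smaller than `L`. -/
noncomputable def smallTotal {n : ℕ} (G : SimpleGraph (Fin n)) (L : ℕ) : ℕ :=
  ∑ᶠ c ∈ {c : G.ConnectedComponent | c.supp.ncard < L}, c.supp.ncard

/-- `D(L)`: the number of clusters (connected components) of size at least `L`. -/
noncomputable def largeCount {n : ℕ} (G : SimpleGraph (Fin n)) (L : ℕ) : ℕ :=
  {c : G.ConnectedComponent | L ≤ c.supp.ncard}.ncard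

/-- The minimum of `n + C(L) log (C(L) / L)` over `L ≥ 2` with `C(L) < n`; it is `⊤` if there is no
such `L`. If `C(L) = 0`, the product is `0`. -/
noncomputable def medianTerm {n : ℕ} (G : SimpleGraph (Fin n)) : EReal :=
  ⨅ (L : ℕ) (_ : 2 ≤ L) (_ : smallTotal G L < n),
    ((n + smallTotal G L * Real.logb 2 (smallTotal G L / L) : ℝ) : EReal)

/-- The minimum of `(C(L) + D(L)) max {1, log D(L)}` over `L ≥ 1` with `C(L) < n / 2`; it is `⊤` if
there is no such `L`. -/
noncomputable def blockTerm {n : ℕ} (G : SimpleGraph (Fin n)) : EReal :=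
  ⨅ (L : ℕ) (_ : 1 ≤ L) (_ : (smallTotal G L : ℝ) < n / 2),
    (((smallTotal G L + largeCount G L) * max 1 (Real.logb 2 (largeCount G L)) : ℝ) : EReal)

end ElementDistinctness

/-!
A duplicate is found as soon as a comparison returns `=`, so every step of the algorithm just sorts
some list of positions, and what has to be shown is that one of these lists contains a duplicate
before too many comparisons have been made. Put `ℓ = ⌈log ⌈log n⌉⌉`. The algorithm works in rounds;
round `r` makes `O(ℓ + 1) * 2 ^ r` comparisons, so the total cost is governed by the first round
that is certain to find a duplicate (`Search.runtime_program_le`). Let `C = C(L)` and `D = D(L)`.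

*Block tasks.* For each guess `2 ^ 2 ^ k ≥ D` with `k ≤ ℓ`, a prefix is cut into blocks of length
`4 * 2 ^ 2 ^ k`, and each block is sorted. A block without duplicates has at most `D` positions in
large clusters, so a prefix of more than `2 * (C + D)` positions must contain a block with a
duplicate (`Search.injective_of_isBlockSort`). For the least admissible `k` the logarithm of the
block length is `O(max {1, log D})`. As the guesses are doubly exponential, `ℓ + 1` of them suffice.

*Median tasks.* For each `k ≤ ℓ`, an initial segment of the order with about `n / 2 ^ k` positions
is selected. It is a union of clusters, so if it has more than `C` elements, it contains a whole
cluster of size at least `L`, and cutting it into fewer than `L` blocks puts two elements of that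
cluster into one block (`Search.le_length_of_isBlockSort`). With `n / 2 ^ k` close to `C`, sorting
these blocks costs `O(n + C log (C / L))`; if `C` is below `n / log n`, then `k = ℓ` serves, where
even a full sort of the segment is linear (`exists_median_parameters`).

The segments are found without exact selection, because `O(n ℓ)` comparisons may be spent: blocks of
length `4 ^ ℓ`, about `(log n) ^ 2`, are sorted, every `2 ^ ℓ`-th element of each is taken, and
these `n / 2 ^ ℓ` elements are sorted with `O(n)` comparisons. Ranks in this sample determine ranks
in the input up to an error of order `n / 2 ^ ℓ` (`Search.sortedSample_meets`).
-/

namespace ElementDistinctness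

/-! ### Comparison programs -/

/-- A comparison program on lists of length `n` that computes a value of type `α`. It may only
compare two different positions, and it stops as soon as the answer is `=`, so that only the
continuations for the answers `<` and `>` are stored. -/
inductive Search (n : ℕ) (α : Type) : Type
  | done (a : α) : Search n α
  | query (i j : Fin n) (hij : i ≠ j) (lt gt : Search n α) : Search n α

namespace Search

variable {n : ℕ} {α β : Type} {U : Type u} [LinearOrder U] {I : Fin n → U}

/-- Sequential composition. -/
def bind : Search n α → (α → Search n β) → Search n β
  | done a, f => f a
  | query i j h l g, f => query i j h (l.bind f) (g.bind f)

/-- The decision tree of a program: an answer `=` is reported as a duplicate, and a program that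
runs to its end reports that there is none. -/
def toAlgorithm : Search n α → Algorithm n
  | done _ => .reportDistinct
  | query i j _ l g => .query i j fun o =>
      match o with
      | .lt => l.toAlgorithm
      | .eq => .reportPair i j
      | .gt => g.toAlgorithm

/-- A Hoare triple with a cost: on the input `I` the program makes at most `c` comparisons, and it
either meets two equal entries or ends with a value that satisfies `Q`. In particular, `Q` may be
`False`, and then the program is certain to find a duplicate. -/
def Meets (I : Fin n → U) (Q : α → Prop) : Search n α → ℕ → Prop
  | done a, _ => Q a
  | query i j _ l g, c =>
      ∃ c', c = c' + 1 ∧ (I i < I j → l.Meets I Q c') ∧ (I j < I i → g.Meets I Q c')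

theorem Meets.mono {Q R : α → Prop} {p : Search n α} {c d : ℕ} (h : p.Meets I Q c) (hcd : c ≤ d)
    (hQR : ∀ a, Q a → R a) : p.Meets I R d := by
  induction p generalizing c d with
  | done a => exact hQR a h
  | query i j hij l g ihl ihg =>
    obtain ⟨c', rfl, h1, h2⟩ := h
    exact ⟨d - 1, by omega, fun x => ihl (h1 x) (by omega), fun x => ihg (h2 x) (by omega)⟩

theorem Meets.bind {Q : α → Prop} {R : β → Prop} {p : Search n α} {f : α → Search n β} {c d : ℕ}
    (hp : p.Meets I Q c) (hf : ∀ a, Q a → (f a).Meets I R d) :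
    (p.bind f).Meets I R (c + d) := by
  induction p generalizing c with
  | done a => exact (hf a hp).mono (by omega) fun _ h => h
  | query i j hij l g ihl ihg =>
    obtain ⟨c', rfl, h1, h2⟩ := hp
    exact ⟨c' + d, by omega, fun x => ihl (h1 x), fun x => ihg (h2 x)⟩

/-- A program that is certain to find a duplicate is never continued. -/
theorem Meets.bind_of_false {R : β → Prop} {p : Search n α} {f : α → Search n β} {c : ℕ}
    (hp : p.Meets I (fun _ => False) c) : (p.bind f).Meets I R c :=
  hp.bind (d := 0) fun _ h => h.elim

theorem Meets.runtime_le {Q : α → Prop} {p : Search n α} {c : ℕ} (h : p.Meets I Q c) :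
    p.toAlgorithm.runtime I ≤ c := by
  induction p generalizing c with
  | done a => simp [toAlgorithm, Algorithm.runtime]
  | query i j hij l g ihl ihg =>
    obtain ⟨c', rfl, h1, h2⟩ := h
    rcases lt_trichotomy (I i) (I j) with hlt | heq | hgt
    · have : cmp (I i) (I j) = .lt := by simpa using hlt
      simpa [toAlgorithm, Algorithm.runtime, this] using ihl (h1 hlt)
    · have : cmp (I i) (I j) = .eq := by simpa using heq
      simp [toAlgorithm, Algorithm.runtime, this]
    · have : cmp (I i) (I j) = .gt := by simpa using hgt
      simpa [toAlgorithm, Algorithm.runtime, this] using ihg (h2 hgt)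

theorem Meets.exists_of_output {Q : α → Prop} {p : Search n α} {c : ℕ} (h : p.Meets I Q c)
    (ho : p.toAlgorithm.output I = none) : ∃ a, Q a := by
  induction p generalizing c with
  | done a => exact ⟨a, h⟩
  | query i j hij l g ihl ihg =>
    obtain ⟨c', rfl, h1, h2⟩ := h
    rcases lt_trichotomy (I i) (I j) with hlt | heq | hgt
    · have : cmp (I i) (I j) = .lt := by simpa using hlt
      exact ihl (h1 hlt) (by simpa [toAlgorithm, Algorithm.output, this] using ho)
    · have : cmp (I i) (I j) = .eq := by simpa using heq
      simp [toAlgorithm, Algorithm.output, this] at ho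
    · have : cmp (I i) (I j) = .gt := by simpa using hgt
      exact ihg (h2 hgt) (by simpa [toAlgorithm, Algorithm.output, this] using ho)

theorem ne_and_eq_of_output {p : Search n α} {i j : Fin n}
    (ho : p.toAlgorithm.output I = some (i, j)) : i ≠ j ∧ I i = I j := by
  induction p with
  | done a => simp [toAlgorithm, Algorithm.output] at ho
  | query i' j' hij l g ihl ihg =>
    rcases lt_trichotomy (I i') (I j') with hlt | heq | hgt
    · have : cmp (I i') (I j') = .lt := by simpa using hlt
      exact ihl (by simpa [toAlgorithm, Algorithm.output, this] using ho)
    · have : cmp (I i') (I j') = .eq := by simpa using heq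
      simp only [toAlgorithm, Algorithm.output, this, Option.some.injEq, Prod.mk.injEq] at ho
      obtain ⟨rfl, rfl⟩ := ho
      exact ⟨hij, heq⟩
    · have : cmp (I i') (I j') = .gt := by simpa using hgt
      exact ihg (by simpa [toAlgorithm, Algorithm.output, this] using ho)

/-- Run `f 0, …, f (N - 1)` one after the other and discard their values. -/
def loop (f : ℕ → Search n α) : ℕ → Search n Unit
  | 0 => done ()
  | N + 1 => (loop f N).bind fun _ => (f N).bind fun _ => done ()

theorem loop_meets {f : ℕ → Search n α} {c : ℕ → ℕ} {N : ℕ}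
    (hf : ∀ i < N, (f i).Meets I (fun _ => True) (c i)) :
    (loop f N).Meets I (fun _ => True) (∑ i ∈ Finset.range N, c i) := by
  induction N with
  | zero => trivial
  | succ N ih =>
    rw [Finset.sum_range_succ]
    exact (ih fun i hi => hf i (by omega)).bind fun _ _ =>
      (hf N (by omega)).bind (d := 0) fun _ _ => trivial

theorem loop_meets_false {f : ℕ → Search n α} {c : ℕ → ℕ} {N i₀ : ℕ}
    (hf : ∀ i < N, (f i).Meets I (fun _ => True) (c i)) (hi₀ : i₀ < N)
    (hfalse : (f i₀).Meets I (fun _ => False) (c i₀)) :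
    (loop f N).Meets I (fun _ => False) (∑ i ∈ Finset.range (i₀ + 1), c i) := by
  induction N with
  | zero => omega
  | succ N ih =>
    rcases Nat.lt_or_ge i₀ N with h | h
    · exact (ih (fun i hi => hf i (by omega)) h).bind_of_false
    · obtain rfl : i₀ = N := by omega
      rw [Finset.sum_range_succ]
      exact (loop_meets fun i hi => hf i (by omega)).bind fun _ _ => hfalse.bind_of_false

/-- Decide whether `x = y` as positions or `I x < I y`, with at most one comparison. -/
def compareLE (x y : Fin n) : Search n Bool :=
  if h : x = y then done true else query x y h (done true) (done false)

theorem compareLE_meets (x y : Fin n) :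
    (compareLE x y).Meets I
      (fun b => (b = true → x = y ∨ I x < I y) ∧ (b = false → I y < I x)) 1 := by
  unfold compareLE
  split_ifs with h
  · simp [Meets, h]
  · exact ⟨0, rfl, fun h => by simp [Meets, h], fun h => by simp [Meets, h]⟩

/-! ### Sorting -/

/-- The entries at the listed positions are strictly increasing. -/
def Sorted (I : Fin n → U) (l : List (Fin n)) : Prop := l.Pairwise fun i j => I i < I j

theorem Sorted.map_nodup {l : List (Fin n)} (h : Sorted I l) : (l.map I).Nodup :=
  List.pairwise_map.2 (h.imp fun h => h.ne)

theorem Sorted.injective {l : List (Fin n)} (h : Sorted I l) (hl : ∀ i, i ∈ l) :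
    Function.Injective I := fun i j hij =>
  List.inj_on_of_nodup_map h.map_nodup (hl i) (hl j) hij

/-- Binary search insertion of `x` into a sorted list of length less than `2 ^ f`. -/
def insert (x : Fin n) : ℕ → List (Fin n) → Search n (List (Fin n))
  | 0, l => done (x :: l)
  | f + 1, l =>
    match l.drop (l.length / 2) with
    | [] => done [x]
    | y :: r => (compareLE x y).bind fun b =>
        if b then (insert x f (l.take (l.length / 2))).bind fun s => done (s ++ y :: r)
        else (insert x f r).bind fun s => done (l.take (l.length / 2) ++ y :: s)

theorem insert_meets (x : Fin n) {f : ℕ} {l : List (Fin n)} (hl : Sorted I l) (hx : x ∉ l)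
    (hf : l.length < 2 ^ f) :
    (insert x f l).Meets I (fun s => s.Perm (x :: l) ∧ Sorted I s) f := by
  induction f generalizing l with
  | zero =>
    obtain rfl : l = [] := List.length_eq_zero_iff.1 (by simpa using hf)
    exact ⟨List.Perm.refl _, List.pairwise_singleton _ _⟩
  | succ f ih =>
    rw [pow_succ] at hf
    have hlen := List.length_drop (i := l.length / 2) (l := l)
    have htd := List.take_append_drop (l.length / 2) l
    have htl := List.length_take (i := l.length / 2) (l := l)
    unfold insert
    split
    · rename_i h
      rw [h] at hlen
      obtain rfl : l = [] := List.length_eq_zero_iff.1 (by simp at hlen; omega)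
      exact ⟨List.Perm.refl _, List.pairwise_singleton _ _⟩
    · rename_i y r h
      rw [h] at hlen htd
      simp only [List.length_cons] at hlen
      obtain ⟨m, hm⟩ : ∃ m, l.length / 2 = m := ⟨_, rfl⟩
      rw [hm] at hlen htd htl ⊢
      obtain ⟨t, ht⟩ : ∃ t, l.take m = t := ⟨_, rfl⟩
      rw [ht] at htd htl ⊢
      clear h ht
      subst htd
      simp only [List.length_append, List.length_cons] at *
      simp only [List.mem_append, List.mem_cons, not_or] at hx
      obtain ⟨ht, hyr, htyr⟩ := List.pairwise_append.1 hl
      obtain ⟨hy, hr⟩ := List.pairwise_cons.1 hyr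
      rw [add_comm]
      refine (compareLE_meets x y).bind fun b hb => ?_
      cases b with
      | true =>
        have hxy : I x < I y := (hb.1 rfl).resolve_left hx.2.1
        refine (ih ht hx.1 (by omega)).bind (d := 0) fun s hs => ⟨?_, ?_⟩
        · exact hs.1.append_right _
        · refine List.pairwise_append.2 ⟨hs.2, hyr, fun a ha d hd => ?_⟩
          rcases List.mem_cons.1 (hs.1.mem_iff.1 ha) with rfl | ha
          · rcases List.mem_cons.1 hd with rfl | hd
            · exact hxy
            · exact hxy.trans (hy _ hd)
          · exact htyr _ ha _ hd
      | false =>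
        have hxy : I y < I x := hb.2 rfl
        refine (ih hr hx.2.2 (by omega)).bind (d := 0) fun s hs => ⟨?_, ?_⟩
        · exact ((hs.1.cons y).append_left t).trans
            (((List.Perm.swap _ _ _).append_left t).trans List.perm_middle)
        · have hys : ∀ a ∈ s, I y < I a := fun a ha => by
            rcases List.mem_cons.1 (hs.1.mem_iff.1 ha) with rfl | ha
            · exact hxy
            · exact hy _ ha
          refine List.pairwise_append.2 ⟨ht, List.pairwise_cons.2 ⟨hys, hs.2⟩, fun a ha d hd => ?_⟩
          have hay := htyr a ha y (by simp)
          rcases List.mem_cons.1 hd with rfl | hd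
          · exact hay
          · exact hay.trans (hys _ hd)

/-- Binary insertion sort of a list of length at most `2 ^ f`. -/
def sort (f : ℕ) : List (Fin n) → Search n (List (Fin n))
  | [] => done []
  | x :: l => (sort f l).bind (insert x f)

theorem sort_meets {f : ℕ} {l : List (Fin n)} (hl : l.Nodup) (hf : l.length ≤ 2 ^ f) :
    (sort f l).Meets I (fun s => s.Perm l ∧ Sorted I s) (l.length * f) := by
  induction l with
  | nil => exact ⟨List.Perm.refl _, List.Pairwise.nil⟩
  | cons x l ih =>
    rw [List.nodup_cons] at hl
    rw [List.length_cons] at hf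
    rw [List.length_cons, Nat.succ_mul]
    refine (ih hl.2 (by omega)).bind fun s hs => ?_
    refine (insert_meets x hs.2 (fun h => hl.1 (hs.1.mem_iff.1 h)) ?_).mono le_rfl
      fun t ht => ⟨ht.1.trans (hs.1.cons x), ht.2⟩
    rw [hs.1.length_eq]
    omega

/-- Cut off `q` blocks of length `2 ^ f` from the front of a list, and sort these and the rest. -/
def sortBlocksAux (f : ℕ) : ℕ → List (Fin n) → Search n (List (List (Fin n)))
  | 0, l => (sort f l).bind fun s => done [s]
  | q + 1, l => (sort f (l.take (2 ^ f))).bind fun s =>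
      (sortBlocksAux f q (l.drop (2 ^ f))).bind fun L => done (s :: L)

/-- Cut a list into blocks of length `2 ^ f`, and a shorter last one, and sort each block. -/
def sortBlocks (f : ℕ) (l : List (Fin n)) : Search n (List (List (Fin n))) :=
  sortBlocksAux f (l.length / 2 ^ f) l

/-- The lists in `L` are sorted, and together they are a permutation of `l`. -/
structure IsBlockSort (I : Fin n → U) (l : List (Fin n)) (L : List (List (Fin n))) : Prop where
  perm : L.flatten.Perm l
  sorted : ∀ s ∈ L, Sorted I s

theorem sortBlocksAux_meets {f q : ℕ} {l : List (Fin n)} (hl : l.Nodup)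
    (hf : l.length ≤ (q + 1) * 2 ^ f) :
    (sortBlocksAux f q l).Meets I (fun L => IsBlockSort I l L ∧ L.length = q + 1)
      (l.length * f) := by
  induction q generalizing l with
  | zero =>
    refine (sort_meets hl (by omega)).bind (d := 0) fun s hs => ⟨⟨?_, ?_⟩, rfl⟩
    · simpa using hs.1
    · simpa using hs.2
  | succ q ih =>
    rw [Nat.succ_mul] at hf
    have hlen : l.length * f = (l.take (2 ^ f)).length * f + (l.drop (2 ^ f)).length * f := by
      conv_lhs => rw [← List.take_append_drop (2 ^ f) l]
      rw [List.length_append, Nat.add_mul]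
    rw [hlen]
    refine (sort_meets (hl.sublist (List.take_sublist _ _)) (by simp)).bind fun s hs =>
      (ih (hl.sublist (List.drop_sublist _ _)) (by simp; omega)).bind (d := 0)
        fun L hL => ⟨⟨?_, ?_⟩, ?_⟩
    · conv_rhs => rw [← List.take_append_drop (2 ^ f) l]
      exact hs.1.append hL.1.perm
    · intro t ht
      rcases List.mem_cons.1 ht with rfl | ht
      · exact hs.2
      · exact hL.1.sorted _ ht
    · simp [hL.2]

theorem sortBlocks_meets (f : ℕ) {l : List (Fin n)} (hl : l.Nodup) :
    (sortBlocks f l).Meets I (fun L => IsBlockSort I l L ∧ L.length = l.length / 2 ^ f + 1)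
      (l.length * f) :=
  sortBlocksAux_meets hl ((Nat.div_lt_iff_lt_mul (by positivity)).1 (Nat.lt_succ_self _)).le

/-- Each sorted block holds every value at most once, so positions whose entries take few values
are few. -/
theorem IsBlockSort.countP_le {l : List (Fin n)} {L : List (List (Fin n))}
    (h : IsBlockSort I l L) (p : Fin n → Bool) (V : Finset U) (hV : ∀ i, p i = true → I i ∈ V) :
    l.countP p ≤ L.length * V.card := by
  rw [← h.perm.countP_eq, List.countP_flatten, ← List.length_map (as := L) (f := List.countP p),
    ← smul_eq_mul]
  refine List.sum_le_card_nsmul _ _ fun c hc => ?_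
  obtain ⟨s, hs, rfl⟩ := List.mem_map.1 hc
  have hnd : ((s.filter p).map I).Nodup :=
    (h.sorted s hs).map_nodup.sublist (List.filter_sublist.map I)
  rw [List.countP_eq_length_filter, ← List.length_map (f := I), ← List.toFinset_card_of_nodup hnd]
  refine Finset.card_le_card fun v hv => ?_
  obtain ⟨i, hi, rfl⟩ := List.mem_map.1 (List.mem_toFinset.1 hv)
  exact hV i (List.mem_filter.1 hi).2

/-! ### Clusters of the input -/

/-- The number of positions that hold the same entry as the position `i`. -/
def clusterSize (I : Fin n → U) (i : Fin n) : ℕ := (Finset.univ.filter fun j => I j = I i).card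

/-- The number of positions in clusters of size smaller than `L`. -/
def smallCard (I : Fin n → U) (L : ℕ) : ℕ := (Finset.univ.filter fun i => clusterSize I i < L).card

/-- The entries that occur at least `L` times. -/
def largeValues (I : Fin n → U) (L : ℕ) : Finset U :=
  (Finset.univ.filter fun i => L ≤ clusterSize I i).image I

theorem countP_le_card {l : List (Fin n)} (hl : l.Nodup) (p : Fin n → Bool) :
    l.countP p ≤ (Finset.univ.filter fun i => p i = true).card := by
  rw [List.countP_eq_length_filter, ← List.toFinset_card_of_nodup (hl.filter p)]
  exact Finset.card_le_card fun i hi => by simpa using (List.mem_filter.1 (List.mem_toFinset.1 hi)).2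

theorem length_le_smallCard_add {l : List (Fin n)} (hl : l.Nodup) (L : ℕ) :
    l.length ≤ smallCard I L + l.countP fun i => decide (L ≤ clusterSize I i) := by
  have h := List.length_eq_countP_add_countP (fun i => decide (L ≤ clusterSize I i)) (l := l)
  have h2 := countP_le_card hl fun i => decide ¬(decide (L ≤ clusterSize I i) = true)
  have h3 : (Finset.univ.filter fun i =>
      (decide ¬(decide (L ≤ clusterSize I i) = true)) = true).card = smallCard I L := by
    simp [smallCard]
  omega

/-- If few entries are large, and most positions are in large clusters, then a long enough prefix
cannot be cut into blocks without duplicates whose length is at least four times the number of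
large entries, unless a single block holds the whole input. -/
theorem injective_of_isBlockSort {m L B : ℕ} {S : List (List (Fin n))}
    (hS : IsBlockSort I ((List.finRange n).take m) S)
    (hlen : S.length = ((List.finRange n).take m).length / B + 1)
    (hB : 4 * (largeValues I L).card ≤ B) (hC : 2 * smallCard I L < n)
    (hm : 2 * (smallCard I L + (largeValues I L).card) < m) : Function.Injective I := by
  set l := (List.finRange n).take m with hl
  have hnd : l.Nodup := (List.nodup_finRange n).sublist (List.take_sublist _ _)
  have hll : l.length = min m n := by simp [hl]
  have h1 := length_le_smallCard_add (I := I) hnd L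
  have h2 := hS.countP_le (fun i => decide (L ≤ clusterSize I i)) (largeValues I L) fun i hi =>
    Finset.mem_image_of_mem _ (by simpa using hi)
  rw [hlen] at h2
  have h3 : l.length / B * B ≤ l.length := Nat.div_mul_le_self _ _
  generalize (largeValues I L).card = D at *
  generalize smallCard I L = C at *
  rcases Nat.eq_zero_or_pos (l.length / B) with hq | hq
  · rw [hq] at h2 hlen
    rcases Nat.lt_or_ge m n with hmn | hmn
    · omega
    · obtain ⟨s, rfl⟩ := List.length_eq_one_iff.1 hlen
      refine (hS.sorted s (by simp)).injective fun i => ?_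
      have hp := hS.perm
      rw [List.flatten_singleton] at hp
      rw [hp.mem_iff, hl, List.take_of_length_le (by simpa using hmn)]
      exact List.mem_finRange i
  · generalize l.length / B = q at *
    have h4 : q * (4 * D) ≤ l.length := (Nat.mul_le_mul_left q hB).trans h3
    have h5 : D ≤ q * D := Nat.le_mul_of_pos_left D hq
    rw [Nat.add_mul] at h2
    have h6 : q * (4 * D) = 4 * (q * D) := by ring
    omega

/-- A set of positions that is closed under equal entries and has more elements than there are in
small clusters contains a whole large cluster, so it cannot be cut into fewer than `L` blocks
without duplicates. -/
theorem le_length_of_isBlockSort {l : List (Fin n)} {L : ℕ} {S : List (List (Fin n))}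
    (hS : IsBlockSort I l S) (hl : l.Nodup) (hclosed : ∀ i ∈ l, ∀ j, I j = I i → j ∈ l)
    (hC : smallCard I L < l.length) : L ≤ S.length := by
  have h1 := length_le_smallCard_add (I := I) hl L
  obtain ⟨i, hi, hiL⟩ := List.countP_pos_iff.1
    (show 0 < l.countP fun i => decide (L ≤ clusterSize I i) by omega)
  have h2 := hS.countP_le (fun j => decide (I j = I i)) {I i} fun j hj => by simpa using hj
  rw [Finset.card_singleton, mul_one, List.countP_eq_length_filter,
    ← List.toFinset_card_of_nodup (hl.filter _)] at h2
  refine (of_decide_eq_true hiL).trans (le_trans (Finset.card_le_card fun j hj => ?_) h2)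
  simp only [Finset.mem_filter, Finset.mem_univ, true_and] at hj
  simpa [hj] using hclosed i hi j hj

/-! ### Approximate order statistics -/

/-- The entries of a list at the indices `g - 1`, `2 * g - 1`, …; the first argument bounds the
recursion depth. -/
def everyNth (g : ℕ) : ℕ → List (Fin n) → List (Fin n)
  | 0, _ => []
  | d + 1, l =>
    match l.drop (g - 1) with
    | [] => []
    | y :: r => y :: everyNth g d r

theorem everyNth_sublist (g d : ℕ) (l : List (Fin n)) : (everyNth g d l).Sublist l := by
  induction d generalizing l with
  | zero => exact List.nil_sublist _
  | succ d ih =>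
    unfold everyNth
    split
    · exact List.nil_sublist _
    · rename_i y r h
      exact (h ▸ (ih r).cons_cons y).trans (List.drop_sublist (g - 1) l)

/-- The predicate `p` on positions holds for an initial segment of the entries. -/
def IsLower (I : Fin n → U) (p : Fin n → Bool) : Prop :=
  ∀ i j, I i ≤ I j → p j = true → p i = true

theorem everyNth_countP {g d : ℕ} {l : List (Fin n)} (hg : 0 < g) (hl : Sorted I l)
    (hd : l.length ≤ d) {p : Fin n → Bool} (hp : IsLower I p) :
    g * (everyNth g d l).countP p ≤ l.countP p ∧
      l.countP p ≤ g * (everyNth g d l).countP p + g := by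
  induction d generalizing l with
  | zero =>
    obtain rfl : l = [] := List.length_eq_zero_iff.1 (by omega)
    simp [everyNth]
  | succ d ih =>
    have hlen := List.length_drop (i := g - 1) (l := l)
    have htd := List.take_append_drop (g - 1) l
    have htl := List.length_take (i := g - 1) (l := l)
    unfold everyNth
    split
    · rename_i h
      rw [h] at hlen
      have := List.countP_le_length (p := p) (l := l)
      simp at hlen ⊢
      omega
    · rename_i y r h
      rw [h] at hlen htd
      rw [List.length_cons] at hlen
      generalize l.take (g - 1) = t at htd htl
      subst htd
      obtain ⟨ht, hyr, htyr⟩ := List.pairwise_append.1 hl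
      obtain ⟨hy, hr⟩ := List.pairwise_cons.1 hyr
      have ih := ih hr (by omega)
      simp only [List.length_append, List.length_cons] at htl hlen
      rw [List.countP_append]
      cases hpy : p y with
      | true =>
        have : t.countP p = t.length := List.countP_eq_length.2 fun a ha =>
          hp a y (htyr a ha y (by simp)).le hpy
        rw [List.countP_cons_of_pos hpy, List.countP_cons_of_pos hpy, Nat.mul_succ]
        omega
      | false =>
        have hpr : ∀ a ∈ r, ¬ p a = true := fun a ha h => by
          simp [hp y a (hy a ha).le h] at hpy
        have h1 : r.countP p = 0 := List.countP_eq_zero.2 hpr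
        have h2 : (everyNth g d r).countP p = 0 := List.countP_eq_zero.2 fun a ha =>
          hpr a ((everyNth_sublist g d r).subset ha)
        have := List.countP_le_length (p := p) (l := t)
        rw [List.countP_cons_of_neg (by simp [hpy]), List.countP_cons_of_neg (by simp [hpy]), h1, h2]
        omega

/-- Every `g`-th element of each of the given lists. -/
def sample (g : ℕ) (S : List (List (Fin n))) : List (Fin n) :=
  S.flatMap fun s => everyNth g s.length s

theorem sample_sublist (g : ℕ) (S : List (List (Fin n))) : (sample g S).Sublist S.flatten := by
  induction S with
  | nil => exact List.Sublist.refl _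
  | cons s S ih => exact (everyNth_sublist g _ s).append ih

theorem sample_countP {g : ℕ} {S : List (List (Fin n))} (hg : 0 < g) (hS : ∀ s ∈ S, Sorted I s)
    {p : Fin n → Bool} (hp : IsLower I p) :
    g * (sample g S).countP p ≤ S.flatten.countP p ∧
      S.flatten.countP p ≤ g * (sample g S).countP p + S.length * g := by
  induction S with
  | nil => simp [sample]
  | cons s S ih =>
    have h1 := everyNth_countP hg (hS s (by simp)) le_rfl hp
    have h2 := ih fun t ht => hS t (by simp [ht])
    have h3 : sample g (s :: S) = everyNth g s.length s ++ sample g S := rfl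
    rw [h3, List.flatten_cons, List.countP_append, List.countP_append, List.length_cons,
      Nat.mul_add, Nat.succ_mul]
    omega

/-- Sort blocks of length `4 ^ ℓ`, and then the list of every `2 ^ ℓ`-th element of each block. -/
def sortedSample (n ℓ : ℕ) : Search n (List (Fin n)) :=
  (sortBlocks (2 * ℓ) (List.finRange n)).bind fun S => sort (2 ^ ℓ) (sample (2 ^ ℓ) S)

/-- The list `Z` is sorted, and for every initial segment of the entries, `g` times the number of
its elements in `Z` is a lower bound for its size, up to an error of at most `e`. -/
structure IsSortedSample (I : Fin n → U) (g e : ℕ) (Z : List (Fin n)) : Prop where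
  sorted : Sorted I Z
  mul_countP_le : ∀ p, IsLower I p → g * Z.countP p ≤ (List.finRange n).countP p
  countP_le : ∀ p, IsLower I p → (List.finRange n).countP p ≤ g * Z.countP p + e

theorem sortedSample_meets {ℓ : ℕ} (hn : n ≤ 2 ^ 2 ^ ℓ) :
    (sortedSample n ℓ).Meets I (IsSortedSample I (2 ^ ℓ) ((n / 2 ^ (2 * ℓ) + 1) * 2 ^ ℓ))
      (n * (2 * ℓ) + n) := by
  have h := sortBlocks_meets (I := I) (2 * ℓ) (List.nodup_finRange n)
  rw [List.length_finRange] at h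
  refine h.bind fun S hS => ?_
  have hg : 0 < 2 ^ ℓ := by positivity
  have hsub := sample_sublist (2 ^ ℓ) S
  have hnd : (sample (2 ^ ℓ) S).Nodup :=
    ((hS.1.perm.nodup_iff).2 (List.nodup_finRange n)).sublist hsub
  have hle : 2 ^ ℓ * (sample (2 ^ ℓ) S).length ≤ n := by
    have := (sample_countP hg hS.1.sorted (p := fun _ => true) fun _ _ _ h => h).1
    rw [List.countP_true, hS.1.perm.length_eq, List.length_finRange] at this
    exact this
  have hle' : (sample (2 ^ ℓ) S).length ≤ 2 ^ 2 ^ ℓ :=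
    ((Nat.le_mul_of_pos_left _ hg).trans hle).trans hn
  refine (sort_meets hnd hle').mono (by rwa [mul_comm]) fun Z hZ => ⟨hZ.2, fun p hp => ?_,
    fun p hp => ?_⟩
  · rw [hZ.1.countP_eq, ← hS.1.perm.countP_eq]
    exact (sample_countP hg hS.1.sorted hp).1
  · rw [hZ.1.countP_eq, ← hS.1.perm.countP_eq, ← hS.2]
    exact (sample_countP hg hS.1.sorted hp).2

/-- The positions in a list whose entries are at most the entry at `z`. -/
def filterLE (z : Fin n) : List (Fin n) → Search n (List (Fin n))
  | [] => done []
  | x :: l => (compareLE x z).bind fun b => (filterLE z l).bind fun s =>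
      done (if b then x :: s else s)

theorem filterLE_meets (z : Fin n) (l : List (Fin n)) :
    (filterLE z l).Meets I (fun s => s = l.filter fun i => decide (I i ≤ I z)) l.length := by
  induction l with
  | nil => rfl
  | cons x l ih =>
    rw [List.length_cons, add_comm]
    refine (compareLE_meets x z).bind fun b hb => ih.bind (d := 0) fun s hs => ?_
    subst hs
    cases b with
    | true =>
      have : I x ≤ I z := (hb.1 rfl).elim (fun h => h ▸ le_rfl) le_of_lt
      simp [Meets, this]
    | false =>
      have : ¬ I x ≤ I z := (hb.2 rfl).not_ge
      simp [Meets, this]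

/-- Given a sorted sample, select an initial segment of the entries with about `n / 2 ^ k`
positions. -/
def lowerPart (ℓ k : ℕ) (Z : List (Fin n)) : Search n (List (Fin n)) :=
  match Z[n / 2 ^ (k + ℓ)]? with
  | none => done (List.finRange n)
  | some z => filterLE z (List.finRange n)

theorem countP_le_getElem {Z : List (Fin n)} (hZ : Sorted I Z) {t : ℕ} (ht : t < Z.length) :
    Z.countP (fun i => decide (I i ≤ I Z[t])) = t + 1 := by
  induction Z generalizing t with
  | nil => simp at ht
  | cons y Z ih =>
    obtain ⟨hy, hZ⟩ := List.pairwise_cons.1 hZ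
    cases t with
    | zero =>
      have : Z.countP (fun i => decide (I i ≤ I y)) = 0 :=
        List.countP_eq_zero.2 fun a ha => by simpa using hy a ha
      simp [this]
    | succ t =>
      have ht' : t < Z.length := by simpa using ht
      have := hy _ (List.getElem_mem ht')
      rw [List.getElem_cons_succ, List.countP_cons_of_pos (by simpa using this.le), ih hZ ht']

/-- The list `l` consists of different positions, contains with a position all others with the
same entry, and has about `n / 2 ^ k` elements. -/
structure IsLowerPart (I : Fin n → U) (k : ℕ) (l : List (Fin n)) : Prop where
  nodup : l.Nodup
  closed : ∀ i ∈ l, ∀ j, I j = I i → j ∈ l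
  le_length : n ≤ 2 ^ k * l.length
  length_le : 2 ^ k * l.length ≤ 66 * n

theorem lowerPart_meets {ℓ k : ℕ} (hk : k ≤ ℓ) (hℓ : 2 ^ (2 * ℓ) ≤ 32 * n) {Z : List (Fin n)}
    (hZ : IsSortedSample I (2 ^ ℓ) ((n / 2 ^ (2 * ℓ) + 1) * 2 ^ ℓ) Z) :
    (lowerPart ℓ k Z).Meets I (IsLowerPart I k) n := by
  have hkl : 2 ^ k ≤ 2 ^ ℓ := Nat.pow_le_pow_right (by norm_num) hk
  have hk1 : 1 ≤ 2 ^ k := Nat.one_le_two_pow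
  have h2 : 2 ^ (2 * ℓ) = 2 ^ ℓ * 2 ^ ℓ := by rw [two_mul, pow_add]
  have htn : n / 2 ^ (k + ℓ) * (2 ^ k * 2 ^ ℓ) ≤ n := by
    rw [← pow_add]; exact Nat.div_mul_le_self _ _
  have htn' : n < (n / 2 ^ (k + ℓ) + 1) * (2 ^ k * 2 ^ ℓ) := by
    rw [← pow_add]
    exact (Nat.div_lt_iff_lt_mul (by positivity)).1 (Nat.lt_succ_self _)
  have hbn : n / 2 ^ (2 * ℓ) * (2 ^ ℓ * 2 ^ ℓ) ≤ n := by
    rw [← h2]; exact Nat.div_mul_le_self _ _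
  rw [h2] at hℓ
  -- The rounding in the rank of the pivot and the error of the sample cost at most
  -- `2 * (2 ^ ℓ) ^ 2 ≤ 64 * n`.
  have key : ∀ m, m ≤ 2 ^ ℓ * (n / 2 ^ (k + ℓ) + 1) + (n / 2 ^ (2 * ℓ) + 1) * 2 ^ ℓ →
      2 ^ k * m ≤ 66 * n := by
    intro m hm
    generalize n / 2 ^ (k + ℓ) = t at *
    generalize n / 2 ^ (2 * ℓ) = b at *
    generalize 2 ^ ℓ = g at *
    generalize 2 ^ k = K at *
    have h3 := Nat.mul_le_mul_left K hm
    have h4 : K * g ≤ g * g := Nat.mul_le_mul_right g hkl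
    have h5 : b * (K * g) ≤ b * (g * g) := Nat.mul_le_mul_left b h4
    have h6 : K * (g * (t + 1) + (b + 1) * g) = t * (K * g) + K * g + b * (K * g) + K * g := by
      ring
    omega
  unfold lowerPart
  split
  · rename_i h
    rw [List.getElem?_eq_none_iff] at h
    refine ⟨List.nodup_finRange n, fun _ _ j _ => List.mem_finRange j, ?_, ?_⟩
    · rw [List.length_finRange]
      exact Nat.le_mul_of_pos_left n hk1
    · have := hZ.countP_le (fun _ => true) fun _ _ _ h => h
      simp only [List.countP_true] at this
      refine key _ (this.trans ?_)
      gcongr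
      omega
  · rename_i z h
    obtain ⟨ht, rfl⟩ := List.getElem?_eq_some_iff.1 h
    have hlow : IsLower I fun i => decide (I i ≤ I Z[n / 2 ^ (k + ℓ)]) := fun i j hij hj => by
      simp only [decide_eq_true_eq] at hj ⊢
      exact hij.trans hj
    have h3 := hZ.mul_countP_le _ hlow
    have h4 := hZ.countP_le _ hlow
    rw [countP_le_getElem hZ.sorted ht, List.countP_eq_length_filter] at h3 h4
    refine (filterLE_meets _ _).mono (by simp) ?_
    rintro _ rfl
    refine ⟨(List.nodup_finRange n).filter _, fun i hi j hj => ?_, ?_, key _ h4⟩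
    · simpa [hj] using hi
    · refine htn'.le.trans (le_trans (le_of_eq ?_) (Nat.mul_le_mul_left _ h3))
      ring

/-! ### Rounds of block tasks and median tasks -/

/-- Cut the prefix of length `2 ^ (r - k)` into blocks of length `4 * 2 ^ 2 ^ k` and sort these. -/
def blockTask (n r k : ℕ) : Search n (List (List (Fin n))) :=
  if k ≤ r then sortBlocks (2 ^ k + 2) ((List.finRange n).take (2 ^ (r - k))) else done []

theorem blockTask_cost (r k : ℕ) :
    ((List.finRange n).take (2 ^ r)).length * (2 ^ k + 2) ≤ 3 * 2 ^ (k + r) := by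
  have h1 : ((List.finRange n).take (2 ^ r)).length ≤ 2 ^ r := by simp
  have h2 : 1 ≤ 2 ^ k := Nat.one_le_two_pow
  calc _ ≤ 2 ^ r * (3 * 2 ^ k) := Nat.mul_le_mul h1 (by omega)
    _ = _ := by rw [pow_add]; ring

theorem nodup_take_finRange (m : ℕ) : ((List.finRange n).take m).Nodup :=
  (List.nodup_finRange n).sublist (List.take_sublist _ _)

theorem blockTask_meets (r k : ℕ) :
    (blockTask n r k).Meets I (fun _ => True) (3 * 2 ^ r) := by
  unfold blockTask
  split_ifs with h
  · refine (sortBlocks_meets _ (nodup_take_finRange _)).mono ((blockTask_cost _ _).trans ?_)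
      fun _ _ => trivial
    rw [Nat.add_sub_cancel' h]
  · trivial

theorem blockTask_meets_false {s k L : ℕ} (hI : ¬ Function.Injective I)
    (hD : (largeValues I L).card ≤ 2 ^ 2 ^ k) (hC : 2 * smallCard I L < n)
    (hs : 2 * (smallCard I L + (largeValues I L).card) < 2 ^ s) :
    (blockTask n (k + s) k).Meets I (fun _ => False) (3 * 2 ^ (k + s)) := by
  unfold blockTask
  rw [if_pos (Nat.le_add_right k s), Nat.add_sub_cancel_left]
  refine (sortBlocks_meets _ (nodup_take_finRange _)).mono (blockTask_cost _ _) fun S hS =>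
    hI (injective_of_isBlockSort hS.1 hS.2 ?_ hC hs)
  rw [pow_add]
  omega

/-- Select an initial segment with about `n / 2 ^ k` positions, cut it into blocks of length
`2 ^ 2 ^ (k + q)`, and sort these. -/
def medianTask (ℓ : ℕ) (Z : List (Fin n)) (q k : ℕ) : Search n (List (List (Fin n))) :=
  (lowerPart ℓ k Z).bind fun l => sortBlocks (2 ^ (k + q)) l

theorem medianTask_meets_aux {ℓ k : ℕ} (q : ℕ) (hk : k ≤ ℓ) (hℓ : 2 ^ (2 * ℓ) ≤ 32 * n)
    {Z : List (Fin n)} (hZ : IsSortedSample I (2 ^ ℓ) ((n / 2 ^ (2 * ℓ) + 1) * 2 ^ ℓ) Z) :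
    (medianTask ℓ Z q k).Meets I (fun S => ∃ l, IsLowerPart I k l ∧ IsBlockSort I l S ∧
      S.length = l.length / 2 ^ 2 ^ (k + q) + 1) (n + 66 * n * 2 ^ q) := by
  refine (lowerPart_meets hk hℓ hZ).bind fun l hl =>
    (sortBlocks_meets _ hl.nodup).mono ?_ fun S hS => ⟨l, hl, hS⟩
  calc l.length * 2 ^ (k + q) = 2 ^ k * l.length * 2 ^ q := by rw [pow_add]; ring
    _ ≤ _ := Nat.mul_le_mul_right _ hl.length_le

theorem medianTask_meets_false {ℓ k q L : ℕ} (hk : k ≤ ℓ) (hℓ : 2 ^ (2 * ℓ) ≤ 32 * n)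
    {Z : List (Fin n)} (hZ : IsSortedSample I (2 ^ ℓ) ((n / 2 ^ (2 * ℓ) + 1) * 2 ^ ℓ) Z)
    (hL : 2 ≤ L) (hC : 2 ^ k * smallCard I L < n)
    (hq : 132 * n < 2 ^ k * (2 ^ 2 ^ (k + q) * L)) :
    (medianTask ℓ Z q k).Meets I (fun _ => False) (n + 66 * n * 2 ^ q) := by
  refine (medianTask_meets_aux q hk hℓ hZ).mono le_rfl fun S ⟨l, hl, hS, hlen⟩ => ?_
  have h1 := le_length_of_isBlockSort hS hl.nodup hl.closed
    (Nat.lt_of_mul_lt_mul_left (hC.trans_le hl.le_length))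
  have h2 := Nat.div_mul_le_self l.length (2 ^ 2 ^ (k + q))
  have h3 := hl.length_le
  rw [hlen] at h1
  generalize 2 ^ 2 ^ (k + q) = B at *
  generalize l.length / B = x at *
  -- There are `x + 1 ≥ L` blocks, so `L ≤ 2 * x`, and `B * x` is at most the length of the list.
  have h4 : B * L ≤ 2 * l.length :=
    calc B * L ≤ B * (2 * x) := Nat.mul_le_mul_left B (by omega)
      _ = 2 * (x * B) := by ring
      _ ≤ _ := Nat.mul_le_mul_left 2 h2
  have h5 := Nat.mul_le_mul_left (2 ^ k) h4
  have h6 : 2 ^ k * (2 * l.length) = 2 * (2 ^ k * l.length) := by ring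
  omega

/-- The round `r`: all block tasks, and, from round `a` on, all median tasks. Here `2 ^ a` is meant to
be at least `n`, so that the linear cost of the sample is bounded by `2 ^ r`. The sample is computed
anew in each round, which keeps the rounds independent of each other. -/
def round (n a ℓ r : ℕ) : Search n Unit :=
  (loop (blockTask n r) (ℓ + 1)).bind fun _ =>
    if a ≤ r then (sortedSample n ℓ).bind fun Z => loop (medianTask ℓ Z (r - a)) (ℓ + 1)
    else done ()

variable {a ℓ : ℕ}

theorem round_cost {r : ℕ} (ha : n ≤ 2 ^ a) (har : a ≤ r) :
    n * (2 * ℓ) + n + (ℓ + 1) * (n + 66 * n * 2 ^ (r - a)) ≤ (ℓ + 1) * (69 * 2 ^ r) := by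
  have h1 : n * 2 ^ (r - a) ≤ 2 ^ r :=
    calc n * 2 ^ (r - a) ≤ 2 ^ a * 2 ^ (r - a) := Nat.mul_le_mul_right _ ha
      _ = 2 ^ r := by rw [← pow_add, Nat.add_sub_cancel' har]
  have h2 : n ≤ 2 ^ r := ha.trans (Nat.pow_le_pow_right (by norm_num) har)
  calc n * (2 * ℓ) + n + (ℓ + 1) * (n + 66 * n * 2 ^ (r - a))
      ≤ (ℓ + 1) * (3 * n + 66 * (n * 2 ^ (r - a))) := by nlinarith
    _ ≤ _ := Nat.mul_le_mul_left _ (by omega)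

theorem round_meets (r : ℕ) (ha : n ≤ 2 ^ a) (hn : n ≤ 2 ^ 2 ^ ℓ) (hℓ : 2 ^ (2 * ℓ) ≤ 32 * n) :
    (round n a ℓ r).Meets I (fun _ => True) (72 * (ℓ + 1) * 2 ^ r) := by
  have h1 := (loop_meets fun k (_ : k < ℓ + 1) => blockTask_meets (I := I) r k)
  simp only [Finset.sum_const, Finset.card_range, smul_eq_mul] at h1
  have e : 72 * (ℓ + 1) * 2 ^ r = (ℓ + 1) * (3 * 2 ^ r) + (ℓ + 1) * (69 * 2 ^ r) := by ring
  rw [e]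
  refine h1.bind fun _ _ => ?_
  split_ifs with har
  · refine Meets.mono ((sortedSample_meets hn).bind fun Z hZ => ?_) (round_cost ha har)
      fun _ h => h
    have h2 := loop_meets (N := ℓ + 1) fun k hk =>
      (medianTask_meets_aux (r - a) (Nat.lt_succ_iff.1 hk) hℓ hZ).mono le_rfl
        fun _ _ => trivial
    simpa only [Finset.sum_const, Finset.card_range, smul_eq_mul] using h2
  · trivial

theorem round_meets_false_of_block {s k L : ℕ} (hk : k ≤ ℓ) (hI : ¬ Function.Injective I)
    (hD : (largeValues I L).card ≤ 2 ^ 2 ^ k) (hC : 2 * smallCard I L < n)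
    (hs : 2 * (smallCard I L + (largeValues I L).card) < 2 ^ s) :
    (round n a ℓ (k + s)).Meets I (fun _ => False) (72 * (ℓ + 1) * 2 ^ (k + s)) := by
  have h1 := (loop_meets_false (fun i (_ : i < ℓ + 1) => blockTask_meets (I := I) (k + s) i)
    (Nat.lt_succ_iff.2 hk) (blockTask_meets_false hI hD hC hs))
  simp only [Finset.sum_const, Finset.card_range, smul_eq_mul] at h1
  refine h1.bind_of_false.mono ?_ fun _ h => h
  calc (k + 1) * (3 * 2 ^ (k + s)) ≤ (ℓ + 1) * (72 * 2 ^ (k + s)) :=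
        Nat.mul_le_mul (by omega) (by omega)
    _ = _ := by ring

theorem round_meets_false_of_median {q k L : ℕ} (hk : k ≤ ℓ) (ha : n ≤ 2 ^ a)
    (hn : n ≤ 2 ^ 2 ^ ℓ) (hℓ : 2 ^ (2 * ℓ) ≤ 32 * n) (hL : 2 ≤ L)
    (hC : 2 ^ k * smallCard I L < n) (hq : 132 * n < 2 ^ k * (2 ^ 2 ^ (k + q) * L)) :
    (round n a ℓ (a + q)).Meets I (fun _ => False) (72 * (ℓ + 1) * 2 ^ (a + q)) := by
  have h1 := (loop_meets fun k (_ : k < ℓ + 1) => blockTask_meets (I := I) (a + q) k)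
  simp only [Finset.sum_const, Finset.card_range, smul_eq_mul] at h1
  have e : 72 * (ℓ + 1) * 2 ^ (a + q) =
      (ℓ + 1) * (3 * 2 ^ (a + q)) + (ℓ + 1) * (69 * 2 ^ (a + q)) := by ring
  have hcost := round_cost (ℓ := ℓ) ha (Nat.le_add_right a q)
  rw [Nat.add_sub_cancel_left] at hcost
  unfold round
  rw [e, if_pos (Nat.le_add_right a q), Nat.add_sub_cancel_left]
  refine h1.bind fun _ _ => Meets.mono ((sortedSample_meets hn).bind fun Z hZ => ?_) hcost
    fun _ h => h
  have h2 := loop_meets_false (N := ℓ + 1)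
    (fun k hk => (medianTask_meets_aux q (Nat.lt_succ_iff.1 hk) hℓ hZ).mono le_rfl
      fun _ _ => trivial) (Nat.lt_succ_iff.2 hk) (medianTask_meets_false hk hℓ hZ hL hC hq)
  simp only [Finset.sum_const, Finset.card_range, smul_eq_mul] at h2
  exact h2.mono (Nat.mul_le_mul_right _ (by omega)) fun _ h => h

/-- The rounds `0, …, a + ℓ - 1`, and then a full sort. -/
def program (n a ℓ : ℕ) : Search n (List (Fin n)) :=
  (loop (round n a ℓ) (a + ℓ)).bind fun _ => sort (2 ^ ℓ) (List.finRange n)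

theorem sum_cost_le (w N : ℕ) : ∑ r ∈ Finset.range N, w * 2 ^ r ≤ w * 2 ^ N := by
  rw [← Finset.mul_sum]
  exact Nat.mul_le_mul_left w (Nat.geomSum_lt (m := 2) le_rfl (by simp)).le

theorem program_meets (ha : n ≤ 2 ^ a) (hn : n ≤ 2 ^ 2 ^ ℓ) (hℓ : 2 ^ (2 * ℓ) ≤ 32 * n) :
    (program n a ℓ).Meets I (fun _ => Function.Injective I)
      (72 * (ℓ + 1) * 2 ^ (a + ℓ + 1)) := by
  have h1 := loop_meets fun r (_ : r < a + ℓ) => round_meets (I := I) r ha hn hℓ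
  have h2 : (sort (2 ^ ℓ) (List.finRange n)).Meets I (fun _ => Function.Injective I)
      (72 * (ℓ + 1) * 2 ^ (a + ℓ)) := by
    refine (sort_meets (List.nodup_finRange n) (by simpa using hn)).mono ?_ fun s hs =>
      hs.2.injective fun i => hs.1.mem_iff.2 (List.mem_finRange i)
    rw [List.length_finRange, pow_add]
    exact (Nat.mul_le_mul_right _ ha).trans (Nat.le_mul_of_pos_left _ (by positivity))
  refine Meets.mono (h1.bind fun _ _ => h2) ?_ fun _ h => h
  have := sum_cost_le (72 * (ℓ + 1)) (a + ℓ)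
  rw [pow_succ, ← mul_assoc, mul_two]
  omega

/-- If the round `r` is certain to find a duplicate, then the rounds up to `r` bound the cost, also
if `r` is so large that this round is never run. -/
theorem runtime_program_le {r : ℕ} (ha : n ≤ 2 ^ a) (hn : n ≤ 2 ^ 2 ^ ℓ)
    (hℓ : 2 ^ (2 * ℓ) ≤ 32 * n)
    (hr : (round n a ℓ r).Meets I (fun _ => False) (72 * (ℓ + 1) * 2 ^ r)) :
    (program n a ℓ).toAlgorithm.runtime I ≤ 72 * (ℓ + 1) * 2 ^ (r + 1) := by
  rcases Nat.lt_or_ge r (a + ℓ) with h | h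
  · have h1 := loop_meets_false (fun r (_ : r < a + ℓ) => round_meets (I := I) r ha hn hℓ) h hr
    exact (h1.bind_of_false (f := fun _ => sort (2 ^ ℓ) (List.finRange n))
      (R := fun _ => True)).runtime_le.trans (sum_cost_le _ _)
  · exact (program_meets ha hn hℓ).runtime_le.trans
      (Nat.mul_le_mul_left _ (Nat.pow_le_pow_right (by norm_num) (by omega)))

end Search
open Search

/-! ### The duplicate graph -/

section Graph

variable {n : ℕ} {U : Type u} {G : SimpleGraph (Fin n)}

theorem dupGraph_reachable {I : Fin n → U} {i j : Fin n} :
    (dupGraph I).Reachable i j ↔ I i = I j := by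
  refine ⟨fun ⟨w⟩ => ?_, fun h => ?_⟩
  · induction w with
    | nil => rfl
    | cons h w ih => exact h.2.trans (ih w.reachable)
  · by_cases hij : i = j
    · exact hij ▸ SimpleGraph.Reachable.refl i
    · exact SimpleGraph.Adj.reachable ⟨hij, h⟩

theorem reachable_iff_of_iso {I : Fin n → U} (e : dupGraph I ≃g G) {v w : Fin n} :
    G.Reachable v w ↔ I (e.symm v) = I (e.symm w) := by
  rw [← dupGraph_reachable, SimpleGraph.Iso.reachable_iff]

variable [LinearOrder U] {I : Fin n → U}

theorem ncard_supp_eq_clusterSize (e : dupGraph I ≃g G) (v : Fin n) :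
    (G.connectedComponentMk v).supp.ncard = clusterSize I (e.symm v) := by
  have h : (G.connectedComponentMk v).supp =
      e '' ((Finset.univ.filter fun j => I j = I (e.symm v) : Finset (Fin n)) : Set (Fin n)) := by
    ext w
    rw [SimpleGraph.ConnectedComponent.mem_supp_iff, SimpleGraph.ConnectedComponent.eq,
      reachable_iff_of_iso e]
    constructor
    · intro h
      exact ⟨e.symm w, by simpa using h, by simp⟩
    · rintro ⟨j, hj, rfl⟩
      simpa using hj
  rw [h, Set.ncard_image_of_injective _ e.injective, Set.ncard_coe_finset, clusterSize]

theorem smallTotal_eq (e : dupGraph I ≃g G) (L : ℕ) : smallTotal G L = smallCard I L := by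
  classical
  have hfin : Finite G.ConnectedComponent := inferInstance
  have : Fintype G.ConnectedComponent := Fintype.ofFinite _
  have h1 : smallTotal G L =
      ∑ c ∈ Finset.univ.filter (fun c : G.ConnectedComponent => c.supp.ncard < L),
        c.supp.ncard := by
    unfold smallTotal
    rw [← finsum_mem_coe_finset]
    simp
  have h2 : smallCard I L =
      (Finset.univ.filter fun v => (G.connectedComponentMk v).supp.ncard < L).card := by
    unfold smallCard
    refine Finset.card_equiv e.toEquiv fun i => ?_
    simp [ncard_supp_eq_clusterSize e]
  rw [h1, h2, Finset.card_eq_sum_card_fiberwise (f := G.connectedComponentMk)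
    (t := Finset.univ.filter (fun c : G.ConnectedComponent => c.supp.ncard < L))
    (fun v hv => by simpa using hv)]
  refine Finset.sum_congr rfl fun c hc => ?_
  rw [← Set.ncard_coe_finset]
  congr 1
  ext v
  simp only [Finset.mem_filter, Finset.mem_univ, true_and] at hc
  simp only [SimpleGraph.ConnectedComponent.mem_supp_iff, Finset.coe_filter, Finset.mem_filter,
    Finset.mem_univ, true_and, Set.mem_ofPred_eq]
  exact ⟨fun h => ⟨h ▸ hc, h⟩, fun h => h.2⟩

theorem largeCount_eq (e : dupGraph I ≃g G) (L : ℕ) :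
    largeCount G L = (largeValues I L).card := by
  let f : G.ConnectedComponent → U := SimpleGraph.ConnectedComponent.lift (fun v => I (e.symm v))
    fun v w p _ => (reachable_iff_of_iso e).1 p.reachable
  have hf : Function.Injective f := by
    intro c d
    induction c using SimpleGraph.ConnectedComponent.ind with | _ v
    induction d using SimpleGraph.ConnectedComponent.ind with | _ w
    exact fun h => SimpleGraph.ConnectedComponent.eq.2 ((reachable_iff_of_iso e).2 h)
  rw [← Set.ncard_coe_finset, largeCount, ← Set.ncard_image_of_injective _ hf]
  congr 1
  ext x
  simp only [largeValues, Set.mem_image, Set.mem_ofPred_eq, Finset.coe_image, Finset.coe_filter,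
    Finset.mem_univ, true_and]
  constructor
  · rintro ⟨c, hc, rfl⟩
    induction c using SimpleGraph.ConnectedComponent.ind with | _ v
    exact ⟨e.symm v, by rwa [← ncard_supp_eq_clusterSize e], rfl⟩
  · rintro ⟨i, hi, rfl⟩
    refine ⟨G.connectedComponentMk (e i), ?_, ?_⟩
    · rw [ncard_supp_eq_clusterSize e]
      simpa using hi
    · change I (e.symm (e i)) = I i
      simp

/-- Every disjoint union of cliques is the duplicate graph of some input. -/
theorem exists_input (hG : IsCliqueUnion G) :
    ∃ (U : Type u) (_ : LinearOrder U) (I : Fin n → U), Nonempty (dupGraph I ≃g G) := by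
  obtain ⟨m, ⟨f⟩⟩ := Finite.exists_equiv_fin G.ConnectedComponent
  refine ⟨ULift (Fin m), inferInstance, fun v => ⟨f (G.connectedComponentMk v)⟩,
    ⟨⟨Equiv.refl _, fun {v w} => ?_⟩⟩⟩
  simp only [dupGraph, Equiv.refl_apply, ULift.up_inj, f.injective.eq_iff]
  refine ⟨fun h => ⟨h.ne, SimpleGraph.ConnectedComponent.eq.2 h.reachable⟩, fun h => ?_⟩
  exact hG (G.connectedComponentMk w) h.2 rfl h.1

end Graph
/-! ### Estimates for logarithms -/

section Estimates

theorem clog_lt_logb_add_one {x : ℕ} (hx : 1 ≤ x) : (Nat.clog 2 x : ℝ) < Real.logb 2 x + 1 := by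
  rw [← Real.natCeil_logb_natCast 2 x, Nat.cast_ofNat]
  exact Nat.ceil_lt_add_one (Real.logb_nonneg (by norm_num) (by exact_mod_cast hx))

theorem two_pow_clog_le {x : ℕ} (hx : 1 ≤ x) : 2 ^ Nat.clog 2 x ≤ 2 * x := by
  rcases hx.eq_or_lt with rfl | hx
  · simp
  · have h := Nat.pow_pred_clog_lt_self (b := 2) (by norm_num) hx
    have hpos : 0 < Nat.clog 2 x := Nat.clog_pos (by norm_num) hx
    rw [← Nat.succ_pred_eq_of_pos hpos, pow_succ]
    omega

theorem two_pow_clog_clog_le {x : ℕ} (hx : 1 ≤ x) :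
    ((2 ^ Nat.clog 2 (Nat.clog 2 x) : ℕ) : ℝ) ≤ 4 * max 1 (Real.logb 2 x) := by
  have h1 := le_max_left 1 (Real.logb 2 x)
  have h2 := le_max_right 1 (Real.logb 2 x)
  rcases Nat.eq_zero_or_pos (Nat.clog 2 x) with h | h
  · rw [h]
    norm_num
    linarith
  · have h3 : ((2 ^ Nat.clog 2 (Nat.clog 2 x) : ℕ) : ℝ) ≤ ((2 * Nat.clog 2 x : ℕ) : ℝ) :=
      Nat.cast_le.2 (two_pow_clog_le h)
    have h4 := clog_lt_logb_add_one hx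
    push_cast at h3 ⊢
    linarith

theorem le_two_pow_two_pow_clog_clog (n : ℕ) : n ≤ 2 ^ 2 ^ Nat.clog 2 (Nat.clog 2 n) :=
  (Nat.le_pow_clog (by norm_num) n).trans
    (Nat.pow_le_pow_right (by norm_num) (Nat.le_pow_clog (by norm_num) _))

theorem sq_le_four_mul_two_pow (a : ℕ) : a ^ 2 ≤ 4 * 2 ^ a := by
  induction a with
  | zero => norm_num
  | succ a ih =>
    rcases Nat.lt_or_ge a 3 with h | h
    · interval_cases a <;> norm_num
    · rw [pow_succ 2 a]
      nlinarith

theorem two_pow_two_mul_clog_clog_le {n : ℕ} (hn : 1 ≤ n) :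
    2 ^ (2 * Nat.clog 2 (Nat.clog 2 n)) ≤ 32 * n := by
  rcases Nat.eq_zero_or_pos (Nat.clog 2 n) with h | h
  · rw [h]
    norm_num
    omega
  · calc 2 ^ (2 * Nat.clog 2 (Nat.clog 2 n)) = (2 ^ Nat.clog 2 (Nat.clog 2 n)) ^ 2 := by
          rw [← pow_mul, mul_comm]
      _ ≤ (2 * Nat.clog 2 n) ^ 2 := Nat.pow_le_pow_left (two_pow_clog_le h) 2
      _ = 4 * Nat.clog 2 n ^ 2 := by ring
      _ ≤ 4 * (4 * (2 * n)) := by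
          have := sq_le_four_mul_two_pow (Nat.clog 2 n)
          have := two_pow_clog_le hn
          omega
      _ = 32 * n := by ring

theorem half_le_logb_logb {n : ℕ} (hn : 3 ≤ n) : 1 / 2 ≤ Real.logb 2 (Real.logb 2 n) := by
  have h1 : (3 : ℝ) / 2 ≤ Real.logb 2 n := by
    rw [Real.le_logb_iff_rpow_le (by norm_num) (by positivity)]
    calc (2 : ℝ) ^ (3 / 2 : ℝ) = √(2 ^ 3) := by
          rw [Real.sqrt_eq_rpow, ← Real.rpow_natCast, ← Real.rpow_mul (by norm_num)]
          norm_num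
      _ ≤ 3 := by rw [Real.sqrt_le_left (by norm_num)]; norm_num
      _ ≤ n := by exact_mod_cast hn
  rw [Real.le_logb_iff_rpow_le (by norm_num) (by linarith), ← Real.sqrt_eq_rpow]
  refine le_trans ?_ h1
  rw [Real.sqrt_le_left (by norm_num)]
  norm_num

theorem clog_clog_add_one_le {n : ℕ} (hn : 3 ≤ n) :
    (Nat.clog 2 (Nat.clog 2 n) : ℝ) + 1 ≤ 7 * Real.logb 2 (Real.logb 2 n) := by
  have h1 := half_le_logb_logb hn
  have ha : 1 ≤ Nat.clog 2 n := Nat.clog_pos (by norm_num) (by omega)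
  have h2 := clog_lt_logb_add_one ha
  have h3 := clog_lt_logb_add_one (x := n) (by omega)
  have h4 : 1 ≤ Real.logb 2 n := by
    rw [Real.le_logb_iff_rpow_le (by norm_num) (by positivity)]
    norm_num
    exact_mod_cast (by omega : 2 ≤ n)
  have h5 : Real.logb 2 (Nat.clog 2 n) ≤ Real.logb 2 (2 * Real.logb 2 n) :=
    Real.logb_le_logb_of_le (by norm_num) (by exact_mod_cast ha) (by linarith)
  rw [Real.logb_mul (by norm_num) (by positivity), Real.logb_self_eq_one (by norm_num)] at h5
  linarith

theorem two_rpow_two_pow (m : ℕ) : (2 : ℝ) ^ ((2 : ℝ) ^ m : ℝ) = 2 ^ 2 ^ m := by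
  have h := Real.rpow_natCast 2 (2 ^ m)
  rw [Nat.cast_pow, Nat.cast_ofNat] at h
  exact h

theorem neg_le_mul_logb_div {x y : ℝ} (hx : 0 ≤ x) (hy : 0 < y) :
    -(3 / 4 * y) ≤ x * Real.logb 2 (x / y) := by
  rcases hx.eq_or_lt with rfl | hx
  · simp; positivity
  have ht : 0 < x / y := by positivity
  have hu : 0 < √(x / y) := Real.sqrt_pos.2 ht
  have hsq : √(x / y) ^ 2 = x / y := Real.sq_sqrt ht.le
  have h1 := Real.one_sub_inv_le_log_of_pos hu
  rw [Real.log_sqrt ht.le] at h1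
  have hl2 := Real.log_two_gt_d9
  set t := x / y with ht_def
  set u := √t with hu_def
  have hxy : x = t * y := by rw [ht_def]; field_simp
  -- With `u = √t` the bound `log u ≥ 1 - 1 / u` gives `t * log t ≥ 2 * (u ^ 2 - u) ≥ -1 / 2`.
  have h2 : -(1 / 2) ≤ t * Real.log t := by
    have h3 : t * (1 - u⁻¹) = t - u := by
      rw [← hsq]; field_simp
    have h4 := mul_le_mul_of_nonneg_left h1 ht.le
    nlinarith [sq_nonneg (u - 1 / 2)]
  have h3 : -(3 / 4) ≤ t * Real.logb 2 t := by
    rw [Real.logb, ← mul_div_assoc, le_div_iff₀ (by linarith)]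
    linarith
  rw [hxy]
  nlinarith

end Estimates

/-! ### Bounds on the running time -/

section Runtime

variable {n : ℕ} {U : Type u} [LinearOrder U] {I : Fin n → U}

/-- The program for lists of length `n`. -/
def distinctness (n : ℕ) : Search n (List (Fin n)) :=
  program n (Nat.clog 2 n) (Nat.clog 2 (Nat.clog 2 n))

theorem clusterSize_eq_one (hI : Function.Injective I) (i : Fin n) : clusterSize I i = 1 := by
  simp [clusterSize, hI.eq_iff, Finset.filter_eq']

theorem clusterSize_le (i : Fin n) : clusterSize I i ≤ n :=
  (Finset.card_filter_le _ _).trans (by simp)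

theorem exists_le_clusterSize {L : ℕ} (hC : smallCard I L < n) : ∃ i, L ≤ clusterSize I i := by
  by_contra! h
  simp [smallCard, h] at hC

theorem card_largeValues_of_injective {L : ℕ} (hI : Function.Injective I) (hC : smallCard I L < n) :
    (largeValues I L).card = n := by
  obtain ⟨i, hi⟩ := exists_le_clusterSize hC
  rw [clusterSize_eq_one hI] at hi
  simp [largeValues, clusterSize_eq_one hI, hi, Finset.card_image_of_injective _ hI]

theorem runtime_distinctness_le_block {L : ℕ} (hC : 2 * smallCard I L < n) :
    ((distinctness n).toAlgorithm.runtime I : ℝ) ≤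
      2304 * (Nat.clog 2 (Nat.clog 2 n) + 1) *
        ((smallCard I L + (largeValues I L).card) *
          max 1 (Real.logb 2 (largeValues I L).card)) := by
  have hn : 1 ≤ n := by omega
  have ha := Nat.le_pow_clog (b := 2) (by norm_num) n
  have hn2 := le_two_pow_two_pow_clog_clog n
  have hℓ := two_pow_two_mul_clog_clog_le hn
  by_cases hI : Function.Injective I
  · have h1 : ((distinctness n).toAlgorithm.runtime I : ℝ) ≤ _ :=
      Nat.cast_le.2 (program_meets (I := I) ha hn2 hℓ).runtime_le
    have h2 : ((2 ^ Nat.clog 2 n : ℕ) : ℝ) ≤ ((2 * n : ℕ) : ℝ) :=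
      Nat.cast_le.2 (two_pow_clog_le hn)
    have h3 := two_pow_clog_clog_le hn
    rw [card_largeValues_of_injective hI (by omega)]
    generalize Nat.clog 2 (Nat.clog 2 n) = ℓ at *
    generalize Nat.clog 2 n = a at *
    push_cast at h1 h2 h3
    refine h1.trans ?_
    calc (72 * (ℓ + 1) * 2 ^ (a + ℓ + 1) : ℝ) = 72 * (ℓ + 1) * (2 * (2 ^ a * 2 ^ ℓ)) := by
          rw [pow_succ, pow_add]; ring
      _ ≤ 72 * (ℓ + 1) * (2 * ((2 * n) * (4 * max 1 (Real.logb 2 n)))) := by gcongr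
      _ = 1152 * (ℓ + 1) * (n * max 1 (Real.logb 2 n)) := by ring
      _ ≤ _ := by
        gcongr
        · norm_num
        · linarith [Nat.cast_nonneg (α := ℝ) (smallCard I L)]
  · obtain ⟨i, hi⟩ := exists_le_clusterSize (I := I) (L := L) (by omega)
    have hD : 1 ≤ (largeValues I L).card :=
      Finset.card_pos.2 ⟨I i, Finset.mem_image_of_mem _ (by simpa using hi)⟩
    have hDn : (largeValues I L).card ≤ n :=
      (Finset.card_image_le.trans (Finset.card_filter_le _ _)).trans (by simp)
    have hk := Nat.clog_mono_right 2 (Nat.clog_mono_right 2 hDn)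
    have hD2 := le_two_pow_two_pow_clog_clog (largeValues I L).card
    have h3 := two_pow_clog_clog_le hD
    -- The prefix length `2 ^ s` is the least power of two above `2 * (C + D)`.
    obtain ⟨s, hs, hs'⟩ : ∃ s, 2 * (smallCard I L + (largeValues I L).card) < 2 ^ s ∧
        2 ^ s ≤ 4 * (smallCard I L + (largeValues I L).card) := by
      refine ⟨Nat.log 2 (2 * (smallCard I L + (largeValues I L).card)) + 1,
        Nat.lt_pow_succ_log_self (by norm_num) _, ?_⟩
      have := Nat.pow_log_le_self 2
        (x := 2 * (smallCard I L + (largeValues I L).card)) (by omega)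
      rw [pow_succ]
      omega
    have h1 : ((distinctness n).toAlgorithm.runtime I : ℝ) ≤ _ := Nat.cast_le.2
      (runtime_program_le ha hn2 hℓ (round_meets_false_of_block hk hI hD2 hC hs))
    have h2 : ((2 ^ s : ℕ) : ℝ) ≤ ((4 * (smallCard I L + (largeValues I L).card) : ℕ) : ℝ) :=
      Nat.cast_le.2 hs'
    generalize Nat.clog 2 (Nat.clog 2 n) = ℓ at *
    generalize Nat.clog 2 (Nat.clog 2 (largeValues I L).card) = k at *
    generalize (largeValues I L).card = D at *
    generalize smallCard I L = C at *
    push_cast at h1 h2 h3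
    refine h1.trans ?_
    calc (72 * (ℓ + 1) * 2 ^ (k + s + 1) : ℝ) = 72 * (ℓ + 1) * (2 * (2 ^ s * 2 ^ k)) := by
          rw [pow_succ, pow_add]; ring
      _ ≤ 72 * (ℓ + 1) * (2 * ((4 * (C + D)) * (4 * max 1 (Real.logb 2 D)))) := by gcongr
      _ = 2304 * (ℓ + 1) * ((C + D) * max 1 (Real.logb 2 D)) := by ring

/-- Here `2 ^ k` is about `min (n / C) (log n)`, and `q` is the least number such that blocks of
length `2 ^ 2 ^ (k + q)` cut the selected `n / 2 ^ k` positions into fewer than `L` parts; the cost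
of sorting these is about `n * 2 ^ q`. If `2 ^ k` is as large as `log n`, then even sorting all
selected positions takes linear time. -/
theorem exists_median_parameters {C L : ℕ} (hL : 2 ≤ L) (hLn : L ≤ n) (hC : C < n) :
    ∃ k q : ℕ, k ≤ Nat.clog 2 (Nat.clog 2 n) ∧ 2 ^ k * C < n ∧
      132 * n < 2 ^ k * (2 ^ 2 ^ (k + q) * L) ∧
      (n * 2 ^ q : ℝ) ≤ 148 * (n + C * Real.logb 2 (C / L)) := by
  have hT := neg_le_mul_logb_div (x := C) (y := L) (by positivity) (by positivity)
  have hLn' : (L : ℝ) ≤ n := by exact_mod_cast hLn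
  have hL' : (2 : ℝ) ≤ L := by exact_mod_cast hL
  have hC' : (C : ℝ) ≤ n := by exact_mod_cast hC.le
  have hn' : (0 : ℝ) < n := by linarith
  set ℓ := Nat.clog 2 (Nat.clog 2 n) with hℓ
  set k := Nat.findGreatest (fun k => 2 ^ k * C < n) ℓ with hk
  have hkℓ : k ≤ ℓ := Nat.findGreatest_le ℓ
  have hkC : 2 ^ k * C < n :=
    Nat.findGreatest_spec (P := fun k => 2 ^ k * C < n) (Nat.zero_le ℓ) (by simpa using hC)
  have hex : ∃ q, 132 * n < 2 ^ k * (2 ^ 2 ^ (k + q) * L) := by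
    refine ⟨132 * n, ?_⟩
    calc 132 * n < 2 ^ (132 * n) := Nat.lt_two_pow_self
      _ ≤ 2 ^ 2 ^ (k + 132 * n) := by
          refine Nat.pow_le_pow_right (by norm_num) (Nat.lt_two_pow_self.le.trans ?_)
          exact Nat.pow_le_pow_right (by norm_num) (by omega)
      _ ≤ 2 ^ 2 ^ (k + 132 * n) * L := Nat.le_mul_of_pos_right _ (by omega)
      _ ≤ _ := Nat.le_mul_of_pos_left _ (by positivity)
  refine ⟨k, Nat.find hex, hkℓ, hkC, Nat.find_spec hex, ?_⟩
  rcases hq : Nat.find hex with _ | q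
  · norm_num
    linarith
  have hmin := Nat.find_min hex (m := q) (by omega)
  have hmin' : (2 ^ k * (2 ^ 2 ^ (k + q) * L) : ℝ) ≤ 132 * n := by
    exact_mod_cast not_lt.1 hmin
  -- `x` is the approximate number of selected positions.
  set x : ℝ := n / 2 ^ k with hx
  have hx0 : 0 < x := by positivity
  have hxn : x ≤ n := div_le_self hn'.le (one_le_pow₀ (by norm_num))
  have hlog : (2 ^ (k + q) : ℝ) ≤ Real.logb 2 (132 * x / L) := by
    rw [Real.le_logb_iff_rpow_le (by norm_num) (by positivity)]
    rw [two_rpow_two_pow, le_div_iff₀ (by positivity), hx, ← mul_div_assoc,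
      le_div_iff₀ (by positivity)]
    linarith
  have hmain : (n * 2 ^ (q + 1) : ℝ) ≤ 2 * (x * Real.logb 2 (132 * x / L)) := by
    have e : (n * 2 ^ (q + 1) : ℝ) = 2 * (x * 2 ^ (k + q)) := by
      rw [hx, pow_succ, pow_add]; field_simp
    rw [e]
    gcongr
  have hnonneg : 0 ≤ Real.logb 2 (132 * x / L) := le_trans (by positivity) hlog
  refine hmain.trans ?_
  rcases hkℓ.lt_or_eq with hlt | heq
  · have hgt : n ≤ 2 ^ (k + 1) * C := not_lt.1
      (Nat.findGreatest_is_greatest (P := fun k => 2 ^ k * C < n) (Nat.lt_succ_self k) hlt)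
    have hgt' : (n : ℝ) ≤ 2 ^ (k + 1) * C := by exact_mod_cast hgt
    have hx2 : x ≤ 2 * C := by
      rw [hx, div_le_iff₀ (by positivity)]
      rw [pow_succ] at hgt'
      linarith
    have hC0 : (0 : ℝ) < C := by linarith
    have h264 : Real.logb 2 264 ≤ 9 := by
      rw [Real.logb_le_iff_le_rpow (by norm_num) (by norm_num)]
      norm_num
    have h1 : Real.logb 2 (132 * x / L) ≤ 9 + Real.logb 2 (C / L) := by
      have : Real.logb 2 (132 * x / L) ≤ Real.logb 2 (264 * (C / L)) := by
        refine Real.logb_le_logb_of_le (by norm_num) (by positivity) ?_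
        rw [← mul_div_assoc 264]
        have h : 132 * x ≤ 264 * (C : ℝ) := by linarith
        gcongr
      rw [Real.logb_mul (by norm_num) (by positivity)] at this
      linarith
    have h2 : x * Real.logb 2 (132 * x / L) ≤ 2 * C * (9 + Real.logb 2 (C / L)) :=
      mul_le_mul hx2 h1 hnonneg (by positivity)
    linarith
  · have hpow : Real.logb 2 n ≤ 2 ^ k := by
      have h1 : n ≤ 2 ^ 2 ^ k := by rw [heq]; exact le_two_pow_two_pow_clog_clog n
      rw [Real.logb_le_iff_le_rpow (by norm_num) hn']
      rw [two_rpow_two_pow]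
      exact_mod_cast h1
    have h132 : Real.logb 2 132 ≤ 8 := by
      rw [Real.logb_le_iff_le_rpow (by norm_num) (by norm_num)]
      norm_num
    have h1 : Real.logb 2 (132 * x / L) ≤ 8 + 2 ^ k := by
      have : Real.logb 2 (132 * x / L) ≤ Real.logb 2 (132 * n) := by
        refine Real.logb_le_logb_of_le (by norm_num) (by positivity) ?_
        rw [div_le_iff₀ (by positivity)]
        nlinarith
      rw [Real.logb_mul (by norm_num) hn'.ne'] at this
      linarith
    have h2 : x * Real.logb 2 (132 * x / L) ≤ x * (8 + 2 ^ k) :=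
      mul_le_mul_of_nonneg_left h1 hx0.le
    have h3 : x * 2 ^ k = n := by rw [hx]; field_simp
    linarith

theorem runtime_distinctness_le_median {L : ℕ} (hL : 2 ≤ L) (hC : smallCard I L < n) :
    ((distinctness n).toAlgorithm.runtime I : ℝ) ≤
      42624 * (Nat.clog 2 (Nat.clog 2 n) + 1) *
        (n + smallCard I L * Real.logb 2 (smallCard I L / L)) := by
  have hn : 1 ≤ n := by omega
  have ha := Nat.le_pow_clog (b := 2) (by norm_num) n
  have hn2 := le_two_pow_two_pow_clog_clog n
  have hℓ := two_pow_two_mul_clog_clog_le hn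
  obtain ⟨i, hi⟩ := exists_le_clusterSize hC
  obtain ⟨k, q, hk, hkC, hq, hT⟩ :=
    exists_median_parameters hL (hi.trans (clusterSize_le i)) hC
  have h1 : ((distinctness n).toAlgorithm.runtime I : ℝ) ≤ _ := Nat.cast_le.2
    (runtime_program_le ha hn2 hℓ (round_meets_false_of_median hk ha hn2 hℓ hL hkC hq))
  have h2 : ((2 ^ Nat.clog 2 n : ℕ) : ℝ) ≤ ((2 * n : ℕ) : ℝ) :=
    Nat.cast_le.2 (two_pow_clog_le hn)
  generalize Nat.clog 2 (Nat.clog 2 n) = ℓ at *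
  generalize Nat.clog 2 n = a at *
  push_cast at h1 h2
  refine h1.trans ?_
  calc (72 * (ℓ + 1) * 2 ^ (a + q + 1) : ℝ) = 72 * (ℓ + 1) * (2 * (2 ^ a * 2 ^ q)) := by
        rw [pow_succ, pow_add]; ring
    _ ≤ 72 * (ℓ + 1) * (2 * ((2 * n) * 2 ^ q)) := by gcongr
    _ = 288 * (ℓ + 1) * (n * 2 ^ q) := by ring
    _ ≤ 288 * (ℓ + 1) * (148 * (n + smallCard I L * Real.logb 2 (smallCard I L / L))) := by
        gcongr
    _ = _ := by ring

end Runtime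

theorem distinctness_solves (n : ℕ) : Solves.{u} (distinctness n).toAlgorithm := by
  intro U _ I
  refine ⟨fun i j h => ne_and_eq_of_output h, fun h => ?_⟩
  rcases Nat.eq_zero_or_pos n with rfl | hn
  · exact Function.injective_of_subsingleton I
  · obtain ⟨_, hI⟩ := (program_meets (I := I) (Nat.le_pow_clog (by norm_num) n)
      (le_two_pow_two_pow_clog_clog n) (two_pow_two_mul_clog_clog_le hn)).exists_of_output h
    exact hI

theorem universal_le_of_forall {n : ℕ} {A : Algorithm n} {G : SimpleGraph (Fin n)} {t : ℝ}
    (h : ∀ (U : Type u) (_ : LinearOrder U) (I : Fin n → U), Nonempty (dupGraph I ≃g G) →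
      (A.runtime I : ℝ) ≤ t) (ht : 0 ≤ t) :
    ((universal.{u} A G : ENNReal) : EReal) ≤ (t : EReal) := by
  have h1 : universal.{u} A G ≤ ((⌊t⌋₊ : ℕ) : ℕ∞) :=
    iSup_le fun U => iSup_le fun i => iSup_le fun I => iSup_le fun e =>
      Nat.cast_le.2 (Nat.le_floor (h U i I e))
  calc ((universal.{u} A G : ENNReal) : EReal) ≤ ((((⌊t⌋₊ : ℕ) : ℕ∞) : ENNReal) : EReal) := by
        exact_mod_cast h1
    _ = ((⌊t⌋₊ : ℝ) : EReal) := by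
        rw [ENat.toENNReal_coe, ← ENNReal.ofReal_natCast, EReal.coe_ennreal_ofReal,
          max_eq_left (Nat.cast_nonneg _)]
    _ ≤ (t : EReal) := EReal.coe_le_coe_iff.2 (Nat.floor_le ht)

end ElementDistinctness

theorem mainTheorem4 :
    ∃ A : (n : ℕ) → ElementDistinctness.Algorithm n,
      (∀ n : ℕ, ElementDistinctness.Solves.{u} (A n)) ∧
      ∃ c : ℝ, 0 < c ∧
        ∀ n : ℕ, 3 ≤ n → ∀ G : SimpleGraph (Fin n), ElementDistinctness.IsCliqueUnion G →
          ((ElementDistinctness.universal.{u} (A n) G : ENNReal) : EReal) ≤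
            ((c * Real.logb 2 (Real.logb 2 n) : ℝ) : EReal) *
              min (ElementDistinctness.medianTerm G) (ElementDistinctness.blockTerm G) := by
  refine ⟨fun n => (ElementDistinctness.distinctness n).toAlgorithm,
    ElementDistinctness.distinctness_solves, 298368, by norm_num, fun n hn G hG => ?_⟩
  have hlog := ElementDistinctness.half_le_logb_logb hn
  have hℓ := ElementDistinctness.clog_clog_add_one_le hn
  set w := Real.logb 2 (Real.logb 2 n) with hw
  have hc : 0 < 298368 * w := by positivity
  have hterm : ∀ t : ℝ, (∀ (U : Type u) (_ : LinearOrder U) (I : Fin n → U),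
      Nonempty (ElementDistinctness.dupGraph I ≃g G) →
      ((ElementDistinctness.distinctness n).toAlgorithm.runtime I : ℝ) ≤
        42624 * (Nat.clog 2 (Nat.clog 2 n) + 1) * t) →
      ((ElementDistinctness.universal.{u}
        (ElementDistinctness.distinctness n).toAlgorithm G : ENNReal) : EReal) /
          ((298368 * w : ℝ) : EReal) ≤ (t : EReal) := by
    intro t h
    -- Some input realizes `G`, so the bound `t` is not negative.
    obtain ⟨U₀, i₀, I₀, h₀⟩ := ElementDistinctness.exists_input.{u} hG
    have ht : 0 ≤ t := nonneg_of_mul_nonneg_right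
      ((Nat.cast_nonneg _).trans (h U₀ i₀ I₀ h₀)) (by positivity)
    rw [EReal.div_le_iff_le_mul (by exact_mod_cast hc) (EReal.coe_ne_top _), ← EReal.coe_mul]
    refine ElementDistinctness.universal_le_of_forall (fun U i I e => (h U i I e).trans ?_)
      (by positivity)
    nlinarith
  rw [← EReal.div_le_iff_le_mul (by exact_mod_cast hc) (EReal.coe_ne_top _)]
  refine le_min (le_iInf fun L => le_iInf fun hL => le_iInf fun hC => hterm _ ?_)
    (le_iInf fun L => le_iInf fun hL => le_iInf fun hC => hterm _ ?_)
  · rintro U _ I ⟨e⟩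
    rw [ElementDistinctness.smallTotal_eq e] at hC ⊢
    exact ElementDistinctness.runtime_distinctness_le_median hL hC
  · rintro U _ I ⟨e⟩
    rw [ElementDistinctness.smallTotal_eq e] at hC ⊢
    rw [ElementDistinctness.largeCount_eq e]
    have hC' : 2 * ElementDistinctness.Search.smallCard I L < n := by
      have : (2 * ElementDistinctness.Search.smallCard I L : ℝ) < n := by linarith
      exact_mod_cast this
    refine (ElementDistinctness.runtime_distinctness_le_block hC').trans ?_
    gcongr
    norm_num
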